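/- Let $\alpha_k=\lceil 2^k/k^2\rceil$ for $k\ge 1$. Let $S$ be the following infinite rooted graph with edges labelled by $a,b$. Level $1$ consists of one cycle of length $2\alpha_1$, whose starting point is the root $o$; for every $k\ge 1$, each cycle $C$ of level $k$ is joined to two new cycles of level $k+1$, each of length $2\alpha_{k+1}$, by a 3-cycle (the branching cycle) whose vertices are the point of $C$ opposite to its starting point and the starting points of the two new cycles. Let $a$ be the permutation of the vertices of $S$ that moves every vertex one step forward along its (consistently oriented) cycle of length $2\alpha_k$, and let $b$ be the permutation that rotates every branching cycle cyclically and fixes every other vertex. Let $\Gamma$ be the group of permutations of $S$ generated by $a$ and $b$, acting on $S$ from the right by $(x,g)\mapsto x.g$. Let $G=\mathbb{Z}_2\wr_S\Gamma=\bigl(\bigoplus_S\mathbb{Z}_2\bigr)\rtimes\Gamma$ be the permutational wreath product, with multiplication $(f,g)(f',g')=(f+f'(\,\cdot\,.g),\,gg')$ and identity $e$. Let $\tilde X_n=\prod_{i=1}^n (l_i,1)(0,g_i)(l_i',1)$ be the switch-walk-switch random walk on $G$, where all $g_i,l_i,l_i'$ are independent, each $g_i$ is uniformly chosen from $a,b,a^{-1},b^{-1}$,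 and each $l_i,l_i'$ is a configuration that vanishes off $o$ and whose value at $o$ is uniform in $\mathbb{Z}_2$. Let $p_n(g,h)$ be the probability that this walk, started at $g$, is at $h$ after $n$ steps. Then there are constants $c,K>0$ and a function $f:\mathbb{N}\to\mathbb{R}$ with $f(n)\to 0$ as $n\to\infty$ such that for all $n\ge 1$ $$p_{2n}(e,e)\ \ge\ K\,e^{-c\,n^{1/2+f(n)}}.$$ -/

import Mathlib

open Filter Topology

noncomputable section

namespace BubbleGroup

/-- Vertices of the graph `S(α)`. The cycles of level `k` are indexed by the binary words `w` of
length `k - 1` (the most recent branching choice is the head of the list), and the cycle indexed by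
`w` is the cyclic group `ℤ / 2α_k`. Position `0` is the starting point of the cycle, position `α_k`
is its middle (rightmost) point. -/
abbrev Vertex (α : ℕ+ → ℕ+) : Type :=
  Σ w : List Bool, ZMod (2 * (α w.length.succPNat : ℕ))

/-- The middle point of the cycle indexed by `w`. -/
def mid (α : ℕ+ → ℕ+) (w : List Bool) : ZMod (2 * (α w.length.succPNat : ℕ)) :=
  ((α w.length.succPNat : ℕ) : ZMod (2 * (α w.length.succPNat : ℕ)))

/-- The root `o`: the starting point of the unique cycle of level one. -/
def root (α : ℕ+ → ℕ+) : Vertex α := ⟨[], 0⟩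

/-- The generator `a` moves every vertex one step forward along its cycle. -/
def permA (α : ℕ+ → ℕ+) : Equiv.Perm (Vertex α) :=
  Equiv.sigmaCongrRight fun _ => Equiv.addRight 1

/-- The generator `b` rotates every branching cycle, whose three vertices are the middle point of a
cycle `w` and the starting points of the two cycles `false :: w`, `true :: w` of the next level.
It fixes all other vertices, in particular the root. -/
def stepB (α : ℕ+ → ℕ+) (x : Vertex α) : Vertex α :=
  if x.2 = mid α x.1 then ⟨false :: x.1, 0⟩
  else if x.2 = 0 then
    match x.1 with
    | [] => root α
    | false :: v => ⟨true :: v, 0⟩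
    | true :: v => ⟨v, mid α v⟩
  else x

theorem mid_ne_zero (α : ℕ+ → ℕ+) (w : List Bool) : mid α w ≠ 0 := by
  intro h
  have h' := (ZMod.natCast_eq_zero_iff _ _).1 h
  have hp := (α w.length.succPNat).pos
  have := Nat.le_of_dvd hp h'
  omega

theorem stepB_mid (α : ℕ+ → ℕ+) (w : List Bool) : stepB α ⟨w, mid α w⟩ = ⟨false :: w, 0⟩ := by
  simp [stepB]

theorem stepB_false (α : ℕ+ → ℕ+) (w : List Bool) :
    stepB α ⟨false :: w, 0⟩ = ⟨true :: w, 0⟩ := by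
  simp [stepB, (mid_ne_zero α (false :: w)).symm]

theorem stepB_true (α : ℕ+ → ℕ+) (w : List Bool) : stepB α ⟨true :: w, 0⟩ = ⟨w, mid α w⟩ := by
  simp [stepB, (mid_ne_zero α (true :: w)).symm]

theorem stepB_root (α : ℕ+ → ℕ+) : stepB α (root α) = root α := by
  exact (if_neg (mid_ne_zero α []).symm).trans (if_pos rfl)

theorem stepB_other (α : ℕ+ → ℕ+) (x : Vertex α) (h : x.2 ≠ mid α x.1) (h0 : x.2 ≠ 0) :
    stepB α x = x := by
  simp [stepB, h, h0]

theorem stepB_stepB_stepB (α : ℕ+ → ℕ+) (x : Vertex α) :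
    stepB α (stepB α (stepB α x)) = x := by
  by_cases h : x.2 = mid α x.1
  · obtain ⟨w, i⟩ := x
    obtain rfl : i = mid α w := h
    rw [stepB_mid, stepB_false, stepB_true]
  by_cases h0 : x.2 = 0
  · obtain ⟨w, i⟩ := x
    obtain rfl : i = 0 := h0
    match w with
    | [] => exact (by simp only [stepB_root] :
        stepB α (stepB α (stepB α (root α))) = root α)
    | false :: v => rw [stepB_false, stepB_true, stepB_mid]
    | true :: v => rw [stepB_true, stepB_mid, stepB_false]
  · simp only [stepB_other α x h h0]

/-- The generator `b` as a permutation of the vertices. -/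
def permB (α : ℕ+ → ℕ+) : Equiv.Perm (Vertex α) where
  toFun := stepB α
  invFun x := stepB α (stepB α x)
  left_inv := stepB_stepB_stepB α
  right_inv := stepB_stepB_stepB α

/-- The bubble group `Γ(α)`, generated by `a` and `b`. It acts on the vertices from the right, so it
is a subgroup of the opposite of the permutation group: `x.g` is `g.unop x` and
`x.(g h) = (x.g).h`. -/
def bubbleGroup (α : ℕ+ → ℕ+) : Subgroup (Equiv.Perm (Vertex α))ᵐᵒᵖ :=
  Subgroup.closure {MulOpposite.op (permA α), MulOpposite.op (permB α)}

/-- The generator `a` as an element of the bubble group. -/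
def genA (α : ℕ+ → ℕ+) : bubbleGroup α :=
  ⟨MulOpposite.op (permA α), Subgroup.subset_closure (by simp)⟩

/-- The generator `b` as an element of the bubble group. -/
def genB (α : ℕ+ → ℕ+) : bubbleGroup α :=
  ⟨MulOpposite.op (permB α), Subgroup.subset_closure (by simp)⟩

/-- The right action `x.g` of the bubble group on the vertices. -/
def act {α : ℕ+ → ℕ+} (x : Vertex α) (g : bubbleGroup α) : Vertex α :=
  (MulOpposite.unop (g : (Equiv.Perm (Vertex α))ᵐᵒᵖ)) x

/-- Finitely supported lamp configurations `⨁_S ℤ₂`, written multiplicatively. -/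
abbrev Lamps (α : ℕ+ → ℕ+) : Type := Multiplicative (Vertex α →₀ ZMod 2)

/-- The action of the bubble group on lamp configurations, `(g • f)(x) = f(x.g)`. -/
def lampAction (α : ℕ+ → ℕ+) : bubbleGroup α →* MulAut (Lamps α) where
  toFun g := AddEquiv.toMultiplicative
    (Finsupp.domCongr (MulOpposite.unop (g : (Equiv.Perm (Vertex α))ᵐᵒᵖ)).symm)
  map_one' := by
    ext f
    rfl
  map_mul' g h := by
    ext f
    rfl

theorem lampAction_apply {α : ℕ+ → ℕ+} (g : bubbleGroup α) (f : Lamps α) (x : Vertex α) :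
    (lampAction α g f).toAdd x = f.toAdd (act x g) := rfl

/-- The permutational wreath product `ℤ₂ ≀_S Γ`, with
`(f, g) (f', g') = (f + f'(·.g), g g')`. -/
abbrev Wreath (α : ℕ+ → ℕ+) : Type := Lamps α ⋊[lampAction α] bubbleGroup α

/-- The switch: the configuration with value `L` at the root and `0` elsewhere, as an element of
the wreath product. -/
def switch (α : ℕ+ → ℕ+) (L : ZMod 2) : Wreath α :=
  SemidirectProduct.inl (Multiplicative.ofAdd (Finsupp.single (root α) L))

/-- The step distribution of the simple random walk on the bubble group: each of
`a, b, a⁻¹, b⁻¹` is chosen with probability `1/4`. -/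
def baseStep (α : ℕ+ → ℕ+) : PMF (bubbleGroup α) :=
  (PMF.uniformOfFintype (Fin 4)).map ![genA α, genB α, (genA α)⁻¹, (genB α)⁻¹]

/-- The step distribution of the switch-walk-switch random walk: the law of
`(l, 1) (0, g) (l', 1)`, where `l`, `l'` are switches with uniform values in `ℤ₂`, `g` is a step of
the simple random walk on the bubble group, and `l`, `g`, `l'` are independent. -/
def swsStep (α : ℕ+ → ℕ+) : PMF (Wreath α) :=
  (PMF.uniformOfFintype (ZMod 2)).bind fun L =>
    (baseStep α).bind fun g =>
      (PMF.uniformOfFintype (ZMod 2)).map fun L' =>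
        switch α L * SemidirectProduct.inr g * switch α L'

/-- The law at time `n` of the switch-walk-switch random walk started at `g`, whose independent
increments with law `swsStep` are multiplied on the right. -/
def walk (α : ℕ+ → ℕ+) (g : Wreath α) : ℕ → PMF (Wreath α)
  | 0 => PMF.pure g
  | n + 1 => (walk α g n).bind fun x => (swsStep α).map fun s => x * s

/-- The transition probability `p_n(g, h)`. -/
def transProb (α : ℕ+ → ℕ+) (n : ℕ) (g h : Wreath α) : ℝ := (walk α g n h).toReal

/-- The scaling sequence `α_k = ⌈2^k / k^2⌉`. -/
def scaling (k : ℕ+) : ℕ+ :=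
  ⟨⌈(2 : ℝ) ^ (k : ℕ) / (k : ℝ) ^ 2⌉₊, Nat.ceil_pos.2 (by positivity)⟩

end BubbleGroup

end

noncomputable section

namespace BubbleGroup

variable {α : ℕ+ → ℕ+}

/-! For any finite set `A`, symmetry of the walk and Cauchy–Schwarz give p_{2n}(e,e) ≥ P(X_n ∈ A)² /
|A| (`sq_sum_transProb_le`), so the task is to find a small set in which the walk stays with fair
probability.

Consider words whose prefixes all have total exponent in `a` within [-r, r], where 2r is less than
every α_k with k > N. Such a word cannot carry a vertex of high level from one branching cycle to
another, so it acts in the same way around all branching cycles of high level and as a shift far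
from them. This is the invariant `Confined`. A confined permutation is therefore determined by its
shift and its action on the first N + 2 levels (`Confined.ext`), and lamps are switched on only at
low level. There are O(4^N) vertices there, whence |A| ≤ exp(C N 4^N) (`ncard_confined_le`).

The exponent of `a` performs a lazy walk on ℤ, which stays in [-r, r] for n steps with probability
at least exp(-C n / r²) (`le_toOuterMeasure_walk`). For the given scaling r can be of order 2^N /
N², so the total cost is of order n N⁴ / 4^N + N 4^N. Taking 4^N of order √n makes this at most a
constant times √n (1 + log n)⁴, and the logarithmic factor is n^{f(n)} with f(n) → 0. -/

/-! ### Charts around the branching cycles -/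

/-- The chart around the branching cycle attached to the middle point of the cycle `w`: three lines
through the three vertices of the branching cycle. -/
def chart (α : ℕ+ → ℕ+) (w : List Bool) : Option Bool → ℤ → Vertex α
  | none, j => ⟨w, mid α w + j⟩
  | some c, j => ⟨c :: w, j⟩

/-- The rotation of the three vertices of a branching cycle. -/
def rot : Option Bool → Option Bool
  | none => some false
  | some false => some true
  | some true => none

theorem permA_apply (w : List Bool) (i : ZMod (2 * (α w.length.succPNat : ℕ))) :
    permA α ⟨w, i⟩ = ⟨w, i + 1⟩ := rfl

theorem permA_inv_apply (w : List Bool) (i : ZMod (2 * (α w.length.succPNat : ℕ))) :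
    (permA α)⁻¹ ⟨w, i⟩ = ⟨w, i - 1⟩ := by
  rw [Equiv.Perm.inv_eq_iff_eq, permA_apply, sub_add_cancel]

theorem permB_apply (x : Vertex α) : permB α x = stepB α x := rfl

theorem permB_inv : (permB α)⁻¹ = permB α * permB α := by
  ext1 x
  rfl

theorem permA_chart (w : List Bool) (τ : Option Bool) (j : ℤ) :
    permA α (chart α w τ j) = chart α w τ (j + 1) := by
  cases τ <;> simp [chart, permA_apply, add_assoc]

theorem permA_inv_chart (w : List Bool) (τ : Option Bool) (j : ℤ) :
    (permA α)⁻¹ (chart α w τ j) = chart α w τ (j - 1) := by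
  rw [Equiv.Perm.inv_eq_iff_eq, permA_chart, sub_add_cancel]

theorem stepB_chart_zero (w : List Bool) (τ : Option Bool) :
    stepB α (chart α w τ 0) = chart α w (rot τ) 0 := by
  rcases τ with _ | _ | _
  · simpa [chart, rot] using stepB_mid α w
  · simpa [chart, rot] using stepB_false α w
  · simpa [chart, rot] using stepB_true α w

theorem chart_injective_left (w : List Bool) {τ τ' : Option Bool} {j j' : ℤ}
    (h : chart α w τ j = chart α w τ' j') : τ = τ' := by
  have h1 := congrArg Sigma.fst h
  rcases τ with _ | _ <;> rcases τ' with _ | _ <;> simp_all [chart]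

theorem length_chart (w : List Bool) (τ : Option Bool) (j : ℤ) :
    w.length ≤ (chart α w τ j).1.length ∧ (chart α w τ j).1.length ≤ w.length + 1 := by
  cases τ <;> simp [chart]

theorem intCast_ne_zero_of_abs_lt {w : List Bool} {j : ℤ} (h0 : j ≠ 0)
    (hj : |j| < α w.length.succPNat) : (j : ZMod (2 * (α w.length.succPNat : ℕ))) ≠ 0 := by
  intro h
  rw [ZMod.intCast_zmod_eq_zero_iff_dvd] at h
  apply h0
  apply Int.eq_zero_of_abs_lt_dvd h
  push_cast
  have := abs_nonneg j
  linarith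

theorem intCast_ne_mid_of_abs_lt {w : List Bool} {j : ℤ}
    (hj : |j| < α w.length.succPNat) :
    (j : ZMod (2 * (α w.length.succPNat : ℕ))) ≠ mid α w := by
  intro h
  rw [mid, ← sub_eq_zero] at h
  have h' : ((j - (α w.length.succPNat : ℕ) : ℤ) : ZMod (2 * (α w.length.succPNat : ℕ))) = 0 := by
    push_cast; exact h
  rw [ZMod.intCast_zmod_eq_zero_iff_dvd] at h'
  obtain ⟨h1, h2⟩ := abs_lt.1 hj
  have := Int.eq_zero_of_abs_lt_dvd h' (by push_cast; rw [abs_lt]; constructor <;> linarith)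
  linarith

theorem mid_add_mid (w : List Bool) : mid α w + mid α w = 0 := by
  have : ((2 * (α w.length.succPNat : ℕ) : ℕ) : ZMod (2 * (α w.length.succPNat : ℕ))) = 0 :=
    ZMod.natCast_self _
  rw [mid, ← two_mul]
  exact_mod_cast this

/-- Branching points on a cycle of high level are more than 2r apart, so the centre of a chart is
the only one seen within distance 2r. -/
theorem stepB_chart_of_ne_zero {N : ℕ} {r : ℤ}
    (hα : ∀ k, N ≤ k → 2 * r < α k.succPNat) {w : List Bool} (hw : N ≤ w.length)
    (τ : Option Bool) {j : ℤ} (hj0 : j ≠ 0) (hj : |j| ≤ 2 * r) :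
    stepB α (chart α w τ j) = chart α w τ j := by
  rcases τ with _ | c
  · have hw := hj.trans_lt (hα _ hw)
    apply stepB_other
    · simpa [chart] using intCast_ne_zero_of_abs_lt hj0 hw
    · intro h
      simp only [chart] at h
      apply intCast_ne_mid_of_abs_lt hw
      exact add_left_cancel (h.trans (mid_add_mid w).symm)
  · have hw : |j| < α (c :: w).length.succPNat :=
      hj.trans_lt (hα _ (hw.trans (by simp)))
    exact stepB_other _ _ (intCast_ne_mid_of_abs_lt hw) (intCast_ne_zero_of_abs_lt hj0 hw)

/-! ### Confined permutations -/

/-- The vertices on the cycles of level at most `N`, and those on the cycles of level `N + 1` within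
distance `r` of position `m`. -/
def nearSet (α : ℕ+ → ℕ+) (N : ℕ) (r m : ℤ) : Set (Vertex α) :=
  {x | x.1.length < N ∨ (x.1.length = N ∧ ∃ j : ℤ, |j| ≤ r ∧ x.2 = ((j + m : ℤ) : ZMod _))}

/-- The properties of the permutation given by a word whose total exponent in `a` is `m` and
whose prefixes all have total exponent in `[-r, r]`: away from the branching points of high level it
is the shift by `m`, around all branching points of high level it is the shift by `m` followed by
the same permutation of the three lines of the chart, and it preserves the part of low level. -/
structure Confined (N : ℕ) (r m : ℤ) (p : Equiv.Perm (Vertex α)) : Prop where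
  apply_far : ∀ (w : List Bool) (i : ZMod (2 * (α w.length.succPNat : ℕ))), N ≤ w.length →
    (∀ j : ℤ, |j| ≤ r → i + j ≠ 0 ∧ i + j ≠ mid α w) → p ⟨w, i⟩ = ⟨w, i + m⟩
  exists_chart : ∃ σ : Option Bool → ℤ → Option Bool, ∀ (w : List Bool), N ≤ w.length →
    ∀ τ j, |j| ≤ r → p (chart α w τ j) = chart α w (σ τ j) (j + m)
  mapsTo : ∀ x ∈ nearSet α N r 0, p x ∈ nearSet α N r m

theorem nearSet_or_chart_or_far (N : ℕ) (r : ℤ) (x : Vertex α) :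
    x ∈ nearSet α N r 0 ∨
      (∃ w τ j, N ≤ w.length ∧ |j| ≤ r ∧ x = chart α w τ j) ∨
      (N ≤ x.1.length ∧ ∀ j : ℤ, |j| ≤ r → x.2 + j ≠ 0 ∧ x.2 + j ≠ mid α x.1) := by
  obtain ⟨w, i⟩ := x
  by_cases hw : w.length < N
  · exact Or.inl (Or.inl hw)
  push Not at hw
  by_cases h : ∀ j : ℤ, |j| ≤ r → i + j ≠ 0 ∧ i + j ≠ mid α w
  · exact Or.inr (Or.inr ⟨hw, h⟩)
  push Not at h
  obtain ⟨j, hj, h⟩ := h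
  by_cases h0 : i + j = 0
  · have hi : i = ((-j : ℤ) : ZMod _) := by
      rw [Int.cast_neg]; exact eq_neg_of_add_eq_zero_left h0
    rcases hw.eq_or_lt with hw | hw
    -- The starting point of a cycle with `w.length = N` branches from a word of length N - 1,
    -- outside the admitted charts; this is why `nearSet` includes a piece of these cycles.
    · exact Or.inl (Or.inr ⟨hw.symm, -j, by simpa using hj, by simpa using hi⟩)
    · rcases w with _ | ⟨c, v⟩
      · simp at hw
      · refine Or.inr (Or.inl ⟨v, some c, -j, ?_, by simpa using hj, ?_⟩)
        · simp only [List.length_cons] at hw; omega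
        · rw [hi]; rfl
  · refine Or.inr (Or.inl ⟨w, none, -j, hw, by simpa using hj, ?_⟩)
    rw [chart, ← h h0]
    simp

theorem Confined.one (N : ℕ) (r : ℤ) : Confined N r 0 (1 : Equiv.Perm (Vertex α)) where
  apply_far w i _ _ := by simp
  exists_chart := ⟨fun τ _ => τ, by simp⟩
  mapsTo x hx := hx

theorem Confined.permA_mul {N : ℕ} {r m : ℤ} {p : Equiv.Perm (Vertex α)} (h : Confined N r m p) :
    Confined N r (m + 1) (permA α * p) where
  apply_far w i hw hi := by
    rw [Equiv.Perm.mul_apply, h.apply_far w i hw hi, permA_apply]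
    push_cast; rw [add_assoc]
  exists_chart := by
    obtain ⟨σ, hσ⟩ := h.exists_chart
    refine ⟨σ, fun w hw τ j hj => ?_⟩
    rw [Equiv.Perm.mul_apply, hσ w hw τ j hj, permA_chart, add_assoc]
  mapsTo x hx := by
    rcases h.mapsTo x hx with hl | ⟨hl, j, hj, hx⟩
    · exact Or.inl hl
    · rw [Equiv.Perm.mul_apply]
      generalize p x = y at *
      obtain ⟨w, i⟩ := y
      rw [permA_apply]
      refine Or.inr ⟨hl, j, hj, ?_⟩
      simp only at hx ⊢
      rw [hx]; push_cast; rw [add_assoc]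

theorem Confined.permA_inv_mul {N : ℕ} {r m : ℤ} {p : Equiv.Perm (Vertex α)}
    (h : Confined N r m p) : Confined N r (m - 1) ((permA α)⁻¹ * p) where
  apply_far w i hw hi := by
    rw [Equiv.Perm.mul_apply, h.apply_far w i hw hi, permA_inv_apply]
    push_cast; rw [add_sub_assoc]
  exists_chart := by
    obtain ⟨σ, hσ⟩ := h.exists_chart
    refine ⟨σ, fun w hw τ j hj => ?_⟩
    rw [Equiv.Perm.mul_apply, hσ w hw τ j hj, permA_inv_chart, add_sub_assoc]
  mapsTo x hx := by
    rcases h.mapsTo x hx with hl | ⟨hl, j, hj, hx⟩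
    · refine Or.inl ?_
      rw [Equiv.Perm.mul_apply]
      generalize p x = y at *
      obtain ⟨w, i⟩ := y
      simpa only [permA_inv_apply] using hl
    · rw [Equiv.Perm.mul_apply]
      generalize p x = y at *
      obtain ⟨w, i⟩ := y
      rw [permA_inv_apply]
      refine Or.inr ⟨hl, j, hj, ?_⟩
      simp only at hx ⊢
      rw [hx]; push_cast; rw [add_sub_assoc]

theorem stepB_mem_nearSet {N : ℕ} {r m : ℤ} (hα : ∀ k, N ≤ k → 2 * r < α k.succPNat)
    (hm : |m| ≤ r) {x : Vertex α} (hx : x ∈ nearSet α N r m) : stepB α x ∈ nearSet α N r m := by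
  obtain ⟨w, i⟩ := x
  have hzero : ∀ v : List Bool, v.length ≤ N → (⟨v, 0⟩ : Vertex α) ∈ nearSet α N r m := by
    intro v hv
    rcases hv.eq_or_lt with hv | hv
    · exact Or.inr ⟨hv, -m, by simpa using hm, by simp⟩
    · exact Or.inl hv
  have hw : w.length ≤ N := by
    rcases hx with h | h
    · exact h.le
    · exact h.1.le
  by_cases hmid : i = mid α w
  · subst hmid
    rw [stepB_mid]
    apply hzero
    rcases hx with h | ⟨h, j, hj, hx⟩
    · exact h
    -- The piece of a boundary cycle lies within 2r of its starting point and so misses the middle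
    -- point, the only exit to higher levels.
    · refine absurd hx.symm (intCast_ne_mid_of_abs_lt ?_)
      have := hα w.length h.ge
      have := abs_add_le j m
      linarith
  by_cases h0 : i = 0
  · subst h0
    match w with
    | [] => exact (stepB_root α).symm ▸ hx
    | false :: v => rw [stepB_false]; exact hzero _ hw
    | true :: v => rw [stepB_true]; exact Or.inl hw
  · rwa [stepB_other α _ hmid h0]

theorem Confined.permB_mul {N : ℕ} {r m : ℤ} {p : Equiv.Perm (Vertex α)}
    (hα : ∀ k, N ≤ k → 2 * r < α k.succPNat) (hm : |m| ≤ r)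
    (h : Confined N r m p) : Confined N r m (permB α * p) where
  apply_far w i hw hi := by
    rw [Equiv.Perm.mul_apply, h.apply_far w i hw hi, permB_apply]
    exact stepB_other _ _ (hi m hm).2 (hi m hm).1
  exists_chart := by
    obtain ⟨σ, hσ⟩ := h.exists_chart
    -- Only a vertex now at the centre of its line is rotated; the others have 0 < |j + m| ≤ 2r and
    -- are fixed. The rule does not involve `w`.
    refine ⟨fun τ j => if j + m = 0 then rot (σ τ j) else σ τ j, fun w hw τ j hj => ?_⟩
    rw [Equiv.Perm.mul_apply, hσ w hw τ j hj, permB_apply]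
    dsimp only
    split_ifs with h0
    · rw [h0, stepB_chart_zero]
    · apply stepB_chart_of_ne_zero hα hw _ h0
      have := abs_add_le j m
      linarith
  mapsTo x hx := stepB_mem_nearSet hα hm (h.mapsTo x hx)

theorem Confined.permB_inv_mul {N : ℕ} {r m : ℤ} {p : Equiv.Perm (Vertex α)}
    (hα : ∀ k, N ≤ k → 2 * r < α k.succPNat) (hm : |m| ≤ r)
    (h : Confined N r m p) : Confined N r m ((permB α)⁻¹ * p) := by
  rw [permB_inv, mul_assoc]
  exact (h.permB_mul hα hm).permB_mul hα hm

/-- Vertices in charts or far from branching points keep word length at least N > 0, so they never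
reach the root. Hence the walk can switch only lamps in `nearSet`. -/
theorem Confined.mem_nearSet_of_apply_eq_root {N : ℕ} {r m : ℤ} {p : Equiv.Perm (Vertex α)}
    (hN : 0 < N) (h : Confined N r m p) {x : Vertex α} (hx : p x = root α) :
    x ∈ nearSet α N r 0 := by
  have hlen : (p x).1.length = 0 := by rw [hx]; rfl
  rcases nearSet_or_chart_or_far N r x with h1 | ⟨w, τ, j, hw, hj, rfl⟩ | ⟨hw, hi⟩
  · exact h1
  · obtain ⟨σ, hσ⟩ := h.exists_chart
    rw [hσ w hw τ j hj] at hlen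
    have := (length_chart (α := α) w (σ τ j) (j + m)).1
    omega
  · obtain ⟨w, i⟩ := x
    rw [h.apply_far w i hw hi] at hlen
    simp only at hlen hw
    omega

/-- A confined permutation is determined by its shift and its values on the vertices of level at
most `N + 2` which it maps to vertices of level at most `N + 2`. -/
theorem Confined.ext {N : ℕ} {r m : ℤ} {p q : Equiv.Perm (Vertex α)}
    (hp : Confined N r m p) (hq : Confined N r m q)
    (h : ∀ x : Vertex α, x.1.length ≤ N + 1 → (p x).1.length ≤ N + 1 →
      (q x).1.length ≤ N + 1 → p x = q x) : p = q := by
  have hnear : ∀ {m : ℤ} {x : Vertex α}, x ∈ nearSet α N r m → x.1.length ≤ N + 1 := by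
    rintro m x (hx | hx)
    · omega
    · exact hx.1.le.trans (Nat.le_succ _)
  ext1 x
  rcases nearSet_or_chart_or_far N r x with h1 | ⟨w, τ, j, hw, hj, rfl⟩ | ⟨hw, hi⟩
  · exact h x (hnear h1) (hnear (hp.mapsTo x h1)) (hnear (hq.mapsTo x h1))
  · obtain ⟨σ, hσ⟩ := hp.exists_chart
    obtain ⟨σ', hσ'⟩ := hq.exists_chart
    -- Since `σ` and `σ'` are the same for all charts, one chart of lowest level suffices for the
    -- comparison.
    have hv : N ≤ (List.replicate N false).length := by simp
    have hlen : ∀ τ j, (chart α (List.replicate N false) τ j).1.length ≤ N + 1 := fun τ j => by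
      simpa using (length_chart (α := α) (List.replicate N false) τ j).2
    have key := h (chart α (List.replicate N false) τ j) (hlen _ _)
      (by rw [hσ _ hv τ j hj]; exact hlen _ _) (by rw [hσ' _ hv τ j hj]; exact hlen _ _)
    rw [hσ _ hv τ j hj, hσ' _ hv τ j hj] at key
    rw [hσ w hw τ j hj, hσ' w hw τ j hj, chart_injective_left _ key]
  · obtain ⟨w, i⟩ := x
    rw [hp.apply_far w i hw hi, hq.apply_far w i hw hi]

/-! ### Return probabilities of the symmetric random walk -/

theorem walk_one_step_first (g : Wreath α) (n : ℕ) :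
    walk α g (n + 1) = (swsStep α).bind fun s => walk α (g * s) n := by
  induction n with
  | zero => simp [walk, PMF.map, Function.comp_def]
  | succ n ih =>
    rw [walk, ih, PMF.bind_bind]
    rfl

theorem walk_add (g : Wreath α) (m n : ℕ) :
    walk α g (m + n) = (walk α g m).bind fun x => walk α x n := by
  induction n with
  | zero => simp [walk]
  | succ n ih => rw [← add_assoc, walk, ih, PMF.bind_bind]; rfl

theorem map_mul_left_walk (g x : Wreath α) (n : ℕ) :
    (walk α x n).map (g * ·) = walk α (g * x) n := by
  induction n with
  | zero => simp [walk, PMF.pure_map]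
  | succ n ih =>
    rw [walk, walk, ← ih, PMF.map_bind, PMF.bind_map]
    simp [PMF.map_comp, Function.comp_def, mul_assoc]

theorem switch_inv (L : ZMod 2) : (switch α L)⁻¹ = switch α L := by
  rw [switch, ← map_inv, ← ofAdd_neg, ← Finsupp.single_neg, ZMod.neg_eq_self_mod_two]

theorem map_inv_baseStep (α : ℕ+ → ℕ+) : (baseStep α).map (·⁻¹) = baseStep α := by
  -- In the list a, b, a⁻¹, b⁻¹, inversion is the shift of the index by 2.
  have h : (PMF.uniformOfFintype (Fin 4)).map (Equiv.addRight (2 : Fin 4)) =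
      PMF.uniformOfFintype (Fin 4) := by
    ext i
    rw [PMF.map_apply, tsum_eq_single (i - 2)]
    · simp
    · intro j hj
      rw [if_neg]
      rintro rfl
      simp at hj
  rw [baseStep]
  conv_rhs => rw [← h]
  rw [PMF.map_comp, PMF.map_comp]
  congr 1
  ext i
  fin_cases i <;> simp

theorem map_inv_swsStep (α : ℕ+ → ℕ+) : (swsStep α).map (·⁻¹) = swsStep α := by
  have h : ∀ (L L' : ZMod 2) (g : bubbleGroup α),
      (switch α L * SemidirectProduct.inr g * switch α L')⁻¹ =
        switch α L' * SemidirectProduct.inr g⁻¹ * switch α L := by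
    intro L L' g
    rw [mul_inv_rev, mul_inv_rev, switch_inv, switch_inv, map_inv, mul_assoc]
  simp only [swsStep, PMF.map_bind, PMF.map_comp, Function.comp_def, h]
  conv_rhs => rw [← map_inv_baseStep]
  simp only [PMF.map, PMF.bind_bind, PMF.pure_bind, Function.comp_def]
  conv_lhs =>
    enter [2, L]
    rw [PMF.bind_comm]
  rw [PMF.bind_comm]
  congr 1
  ext1 L
  rw [PMF.bind_comm]

theorem map_inv_walk (α : ℕ+ → ℕ+) (n : ℕ) : (walk α 1 n).map (·⁻¹) = walk α 1 n := by
  induction n with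
  | zero => simp [walk, PMF.pure_map]
  | succ n ih =>
    conv_lhs => rw [walk]
    conv_rhs => rw [walk_one_step_first, ← map_inv_swsStep]
    simp only [PMF.map, PMF.bind_bind, PMF.pure_bind, Function.comp_def]
    rw [PMF.bind_comm]
    congr 1
    ext1 s
    rw [one_mul]
    conv_rhs => rw [← mul_one s⁻¹, ← map_mul_left_walk, ← ih]
    simp [PMF.map, Function.comp_def]

theorem pmf_map_apply_of_injective {β γ : Type*} (p : PMF β) {f : β → γ}
    (hf : Function.Injective f) (b : β) : p.map f (f b) = p b := by
  rw [PMF.map_apply, tsum_eq_single b]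
  · simp
  · intro c hc
    rw [if_neg fun h => hc (hf h).symm]

theorem walk_apply_one (x : Wreath α) (n : ℕ) : walk α x n 1 = walk α 1 n x := by
  have h := pmf_map_apply_of_injective (walk α 1 n) (mul_right_injective x) x⁻¹
  have h' := pmf_map_apply_of_injective (walk α 1 n) inv_injective x
  rw [map_mul_left_walk, mul_one] at h
  rw [map_inv_walk] at h'
  simp only [mul_inv_cancel] at h
  rw [h, h']

/-- Cauchy–Schwarz on `A`, combined with p_{2n}(e,e) = ∑ p_n(e,x) p_n(x,e) = ∑ p_n(e,x)². -/
theorem sq_sum_transProb_le (n : ℕ) (A : Finset (Wreath α)) :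
    (∑ x ∈ A, transProb α n 1 x) ^ 2 ≤ A.card * transProb α (2 * n) 1 1 := by
  refine sq_sum_le_card_mul_sum_sq.trans ?_
  refine mul_le_mul_of_nonneg_left ?_ (Nat.cast_nonneg _)
  have h : ∑ x ∈ A, walk α 1 n x ^ 2 ≤ walk α 1 (2 * n) 1 := by
    rw [two_mul, walk_add, PMF.bind_apply]
    simp only [walk_apply_one, ← sq]
    exact ENNReal.sum_le_tsum A
  have h' := ENNReal.toReal_mono ((walk α 1 (2 * n)).apply_ne_top 1) h
  rw [ENNReal.toReal_sum fun x _ => ENNReal.pow_ne_top ((walk α 1 n).apply_ne_top x)] at h'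
  simpa [transProb, ENNReal.toReal_pow] using h'

/-! ### The random walk stays confined -/

/-- The elements of the wreath product whose permutation is confined with shift `m` and whose lamps
are off outside the part of low level. -/
def confinedSet (α : ℕ+ → ℕ+) (N : ℕ) (r m : ℤ) : Set (Wreath α) :=
  {x | (∀ v, x.left.toAdd v ≠ 0 → v ∈ nearSet α N r 0) ∧
    Confined N r m (MulOpposite.unop (x.right : (Equiv.Perm (Vertex α))ᵐᵒᵖ))}

theorem one_mem_confinedSet (N : ℕ) (r : ℤ) : (1 : Wreath α) ∈ confinedSet α N r 0 :=
  ⟨fun _ hv => absurd rfl hv, Confined.one N r⟩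

theorem mul_switch_mem_confinedSet {N : ℕ} {r m : ℤ} (hN : 0 < N) {x : Wreath α}
    (hx : x ∈ confinedSet α N r m) (L : ZMod 2) : x * switch α L ∈ confinedSet α N r m := by
  refine ⟨fun v hv => ?_, ?_⟩
  · by_cases h : x.left.toAdd v = 0
    · apply hx.2.mem_nearSet_of_apply_eq_root hN
      by_contra hne
      apply hv
      have h1 : (x * switch α L).left.toAdd v =
          x.left.toAdd v + (Finsupp.single (root α) L) (act v x.right) := rfl
      rw [h1, h, zero_add]
      exact Finsupp.single_eq_of_ne hne
    · exact hx.1 v h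
  · have h : (x * switch α L).right = x.right := by simp [switch]
    rw [h]
    exact hx.2

theorem mul_inr_mem_confinedSet {N : ℕ} {r m m' : ℤ} {x : Wreath α}
    (hx : x ∈ confinedSet α N r m) {g : bubbleGroup α}
    (hg : Confined N r m' (MulOpposite.unop (g : (Equiv.Perm (Vertex α))ᵐᵒᵖ) *
      MulOpposite.unop (x.right : (Equiv.Perm (Vertex α))ᵐᵒᵖ))) :
    x * SemidirectProduct.inr g ∈ confinedSet α N r m' := by
  refine ⟨fun v hv => hx.1 v ?_, hg⟩
  rwa [SemidirectProduct.mul_left, SemidirectProduct.left_inr, map_one, mul_one] at hv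

theorem mul_generator_mem_confinedSet {N : ℕ} {r m : ℤ}
    (hα : ∀ k, N ≤ k → 2 * r < α k.succPNat) (hm : |m| ≤ r) {x : Wreath α}
    (hx : x ∈ confinedSet α N r m) (i : Fin 4) :
    x * SemidirectProduct.inr (![genA α, genB α, (genA α)⁻¹, (genB α)⁻¹] i) ∈
      confinedSet α N r (m + ![1, 0, -1, 0] i) := by
  apply mul_inr_mem_confinedSet hx
  fin_cases i
  · exact hx.2.permA_mul
  · simpa [genB] using hx.2.permB_mul hα hm
  · exact hx.2.permA_inv_mul
  · simpa [genB] using hx.2.permB_inv_mul hα hm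

theorem le_toOuterMeasure_bind {β γ : Type*} (p : PMF β) (f : β → PMF γ) (A : Set γ)
    {c : ENNReal} (h : ∀ b, c ≤ (f b).toOuterMeasure A) : c ≤ (p.bind f).toOuterMeasure A := by
  rw [PMF.toOuterMeasure_bind_apply]
  calc c = ∑' b, p b * c := by rw [ENNReal.tsum_mul_right, p.tsum_coe, one_mul]
    _ ≤ _ := ENNReal.tsum_le_tsum fun b => by gcongr; exact h b

/-- A bound uniform in both switches averages them out, leaving a sum over the four generators. -/
theorem sum_le_toOuterMeasure_swsStep_bind {γ : Type*} (f : Wreath α → PMF γ) (A : Set γ)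
    (c : Fin 4 → ENNReal)
    (h : ∀ L L' i, c i ≤ (f (switch α L *
      SemidirectProduct.inr (![genA α, genB α, (genA α)⁻¹, (genB α)⁻¹] i) *
        switch α L')).toOuterMeasure A) :
    ∑ i, 4⁻¹ * c i ≤ ((swsStep α).bind f).toOuterMeasure A := by
  rw [swsStep, PMF.bind_bind]
  refine le_toOuterMeasure_bind _ _ _ fun L => ?_
  rw [baseStep, PMF.bind_bind, PMF.bind_map, PMF.toOuterMeasure_bind_apply, tsum_fintype]
  refine Finset.sum_le_sum fun i _ => ?_
  rw [PMF.uniformOfFintype_apply, Fintype.card_fin]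
  refine mul_le_mul' (by norm_num) ?_
  simp only [Function.comp_apply]
  rw [PMF.bind_map]
  exact le_toOuterMeasure_bind _ _ _ fun L' => h L L' i

/-- The survival probability of the lazy simple random walk on `[-r, r]` is bounded below by means
of the eigenfunction `m ↦ cos (π m / (2 (r + 1)))`. -/
theorem le_toOuterMeasure_walk {N r : ℕ} (hN : 0 < N)
    (hα : ∀ k, N ≤ k → 2 * (r : ℤ) < α k.succPNat) {θ : ℝ} (hθ : θ * (r + 1) = Real.pi / 2)
    (n : ℕ) : ∀ (m : ℤ) (x : Wreath α), |m| ≤ r → x ∈ confinedSet α N r m →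
      ENNReal.ofReal (Real.cos (θ * m) * ((1 + Real.cos θ) / 2) ^ n) ≤
        (walk α x n).toOuterMeasure {x | ∃ m : ℤ, |m| ≤ r ∧ x ∈ confinedSet α N r m} := by
  induction n with
  | zero =>
    intro m x hm hx
    rw [walk, PMF.toOuterMeasure_pure_apply, if_pos ⟨m, hm, hx⟩, pow_zero, mul_one]
    exact ENNReal.ofReal_le_one.2 (Real.cos_le_one _)
  | succ n ih =>
    intro m x hm hx
    rw [walk_one_step_first]
    refine le_trans ?_ (sum_le_toOuterMeasure_swsStep_bind _ _ (fun i => ENNReal.ofReal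
      (Real.cos (θ * (m + ![1, 0, -1, 0] i : ℤ)) * ((1 + Real.cos θ) / 2) ^ n)) ?_)
    · have h4 : (4⁻¹ : ENNReal) = ENNReal.ofReal 4⁻¹ := by
        rw [ENNReal.ofReal_inv_of_pos (by norm_num)]; norm_num
      have h0 : (0 : ℝ) ≤ 4⁻¹ := by norm_num
      simp only [h4, ← ENNReal.ofReal_mul h0, Fin.sum_univ_four]
      refine le_trans (le_of_eq ?_) ((ENNReal.ofReal_add_le).trans (add_le_add_left
        ((ENNReal.ofReal_add_le).trans (add_le_add_left ENNReal.ofReal_add_le _)) _))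
      -- Eigenfunction identity: (cos θ(m+1) + cos θ(m-1) + 2 cos θm) / 4 = cos θm · (1 + cos θ) /
      -- 2.
      congr 1
      simp [mul_add, Real.cos_add]
      ring
    · intro L L' i
      have hmem : x * (switch α L *
          SemidirectProduct.inr (![genA α, genB α, (genA α)⁻¹, (genB α)⁻¹] i) *
            switch α L') ∈ confinedSet α N r (m + ![1, 0, -1, 0] i) := by
        rw [← mul_assoc, ← mul_assoc]
        exact mul_switch_mem_confinedSet hN
          (mul_generator_mem_confinedSet hα hm (mul_switch_mem_confinedSet hN hx L) i) L'
      by_cases hi : |m + ![1, 0, -1, 0] i| ≤ r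
      · exact ih _ _ hi hmem
      -- A walk leaving the interval lands exactly at ±(r + 1), where the eigenfunction vanishes, so
      -- nothing is claimed there.
      · have hd : |(![1, 0, -1, 0] : Fin 4 → ℤ) i| ≤ 1 := by fin_cases i <;> simp
        have heq : |m + ![1, 0, -1, 0] i| = r + 1 := by
          have := abs_add_le m (![1, 0, -1, 0] i)
          omega
        have hcos : Real.cos (θ * (m + ![1, 0, -1, 0] i : ℤ)) = 0 := by
          generalize m + ![1, 0, -1, 0] i = k at heq
          rcases abs_choice k with h | h <;> rw [h] at heq
          · rw [heq]; push_cast; rw [hθ, Real.cos_pi_div_two]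
          · rw [← Real.cos_neg, ← mul_neg, ← Int.cast_neg, heq]
            push_cast; rw [hθ, Real.cos_pi_div_two]
        rw [hcos, zero_mul, ENNReal.ofReal_zero]
        exact zero_le

/-! ### Counting confined elements -/

/-- The binary words of length at most `n`. -/
def words : ℕ → Finset (List Bool)
  | 0 => {[]}
  | n + 1 => insert [] ((Finset.univ ×ˢ words n).image fun p => p.1 :: p.2)

theorem mem_words {n : ℕ} {w : List Bool} : w ∈ words n ↔ w.length ≤ n := by
  induction n generalizing w with
  | zero => simp [words]
  | succ n ih => cases w <;> simp [words, ih]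

theorem card_words_lt (n : ℕ) : (words n).card < 2 ^ (n + 1) := by
  induction n with
  | zero => simp [words]
  | succ n ih =>
    have h := Finset.card_insert_le []
      (((Finset.univ : Finset Bool) ×ˢ words n).image fun p => p.1 :: p.2)
    have h' := Finset.card_image_le (s := (Finset.univ : Finset Bool) ×ˢ words n)
      (f := fun p => p.1 :: p.2)
    rw [Finset.card_product, Finset.card_univ, Fintype.card_bool] at h'
    rw [words]
    rw [pow_succ]
    omega

/-- The vertices on the cycles of level at most `n + 1`. -/
def lowVertices (α : ℕ+ → ℕ+) (n : ℕ) : Finset (Vertex α) :=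
  (words n).sigma fun _ => Finset.univ

theorem mem_lowVertices {n : ℕ} {x : Vertex α} : x ∈ lowVertices α n ↔ x.1.length ≤ n := by
  simp [lowVertices, mem_words]

theorem card_lowVertices_le (hα : ∀ k : ℕ+, (α k : ℕ) ≤ 2 ^ (k : ℕ)) (n : ℕ) :
    (lowVertices α n).card ≤ 2 ^ (2 * n + 3) := by
  rw [lowVertices, Finset.card_sigma]
  calc _ ≤ ∑ w ∈ words n, 2 * 2 ^ (n + 1) := by
        refine Finset.sum_le_sum fun w hw => ?_
        rw [Finset.card_univ, ZMod.card]
        refine Nat.mul_le_mul_left _ ((hα _).trans ?_)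
        refine Nat.pow_le_pow_right (by norm_num) ?_
        simpa using mem_words.1 hw
    _ = (words n).card * (2 * 2 ^ (n + 1)) := by simp
    _ ≤ 2 ^ (n + 1) * (2 * 2 ^ (n + 1)) := Nat.mul_le_mul_right _ (card_words_lt n).le
    _ = _ := by ring

open Classical in
/-- The data which determine a confined element. -/
def confinedCode (α : ℕ+ → ℕ+) (N r : ℕ)
    (x : {x : Wreath α | ∃ m : ℤ, |m| ≤ r ∧ x ∈ confinedSet α N r m}) :
    Finset.Icc (-(r : ℤ)) r × (lowVertices α (N + 1) → ZMod 2) ×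
      (lowVertices α (N + 1) → lowVertices α (N + 1)) :=
  (⟨x.2.choose, Finset.mem_Icc.2 (abs_le.1 x.2.choose_spec.1)⟩, fun v => x.1.left.toAdd v,
    fun v => if h : act v.1 x.1.right ∈ lowVertices α (N + 1) then ⟨_, h⟩ else v)

theorem confinedCode_injective (N r : ℕ) : Function.Injective (confinedCode α N r) := by
  intro x y h
  simp only [confinedCode, Prod.mk.injEq, Subtype.mk.injEq] at h
  obtain ⟨hm, hl, hr⟩ := h
  have hx := x.2.choose_spec.2
  have hy := y.2.choose_spec.2
  rw [← hm] at hy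
  have hlow : ∀ v ∈ nearSet α N r 0, v ∈ lowVertices α (N + 1) := by
    intro v hv
    rw [mem_lowVertices]
    rcases hv with hv | hv
    · omega
    · exact hv.1.le.trans (Nat.le_succ _)
  have hleft : x.1.left = y.1.left := by
    apply Multiplicative.toAdd.injective
    ext1 v
    by_cases hv : v ∈ lowVertices α (N + 1)
    · exact congrFun hl ⟨v, hv⟩
    · have h1 : x.1.left.toAdd v = 0 := by
        by_contra h; exact hv (hlow v (hx.1 v h))
      have h2 : y.1.left.toAdd v = 0 := by
        by_contra h; exact hv (hlow v (hy.1 v h))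
      rw [h1, h2]
  have hright : x.1.right = y.1.right := by
    apply Subtype.ext
    apply MulOpposite.unop_injective
    refine hx.2.ext hy.2 fun v hv h1 h2 => ?_
    have h := congrFun hr ⟨v, mem_lowVertices.2 hv⟩
    have h1' : act v x.1.right ∈ lowVertices α (N + 1) := mem_lowVertices.2 h1
    have h2' : act v y.1.right ∈ lowVertices α (N + 1) := mem_lowVertices.2 h2
    rw [dif_pos h1', dif_pos h2'] at h
    exact congrArg Subtype.val h
  exact Subtype.ext (SemidirectProduct.ext hleft hright)

theorem finite_confined (N r : ℕ) :
    {x : Wreath α | ∃ m : ℤ, |m| ≤ r ∧ x ∈ confinedSet α N r m}.Finite :=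
  Finite.of_injective _ (confinedCode_injective N r)

theorem ncard_confined_le (hα : ∀ k : ℕ+, (α k : ℕ) ≤ 2 ^ (k : ℕ)) {N r : ℕ} (hr : r < 2 ^ N) :
    {x : Wreath α | ∃ m : ℤ, |m| ≤ r ∧ x ∈ confinedSet α N r m}.ncard ≤
      2 ^ (224 * (N + 1) * 4 ^ N) := by
  have h := Nat.card_le_card_of_injective _ (confinedCode_injective (α := α) N r)
  have hb := card_lowVertices_le hα (N + 1)
  rw [Nat.card_coe_set_eq] at h
  refine h.trans ?_
  simp only [Nat.card_prod, Nat.card_fun, Nat.card_eq_finsetCard, Nat.card_zmod, Int.card_Icc]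
  generalize (lowVertices α (N + 1)).card = b at hb
  have hr' : ((r : ℤ) + 1 - -r).toNat ≤ 2 ^ (N + 1) := by rw [pow_succ]; omega
  have hb' : b ≤ 32 * 4 ^ N := by
    refine hb.trans (le_of_eq ?_)
    rw [show (4 : ℕ) = 2 ^ 2 by norm_num, ← pow_mul]; ring
  calc _ ≤ 2 ^ (N + 1) * (2 ^ b * (2 ^ (2 * (N + 1) + 3)) ^ b) := by gcongr
    _ = 2 ^ ((N + 1) + (b + (2 * (N + 1) + 3) * b)) := by rw [← pow_mul, ← pow_add, ← pow_add]
    _ ≤ _ := by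
      -- With b ≤ 32 · 4^N the exponent is at most (32 (2N + 6) + N + 1) 4^N, and 193 (N + 1)
      -- already bounds the bracket.
      refine Nat.pow_le_pow_right (by norm_num) ?_
      have : 1 ≤ 4 ^ N := Nat.one_le_pow _ _ (by norm_num)
      nlinarith [Nat.mul_le_mul_left (2 * N + 6) hb', Nat.mul_le_mul_left (N + 1) this]

/-! ### The lower bound for the return probability -/

theorem scaling_le (k : ℕ+) : (scaling k : ℕ) ≤ 2 ^ (k : ℕ) := by
  change ⌈(2 : ℝ) ^ (k : ℕ) / (k : ℝ) ^ 2⌉₊ ≤ _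
  rw [Nat.ceil_le]
  push_cast
  apply div_le_self (by positivity)
  have : (1 : ℝ) ≤ k := by exact_mod_cast k.pos
  exact one_le_pow₀ this

theorem mul_succ_sq_lt_two_pow {N r : ℕ} (hN : 2 ≤ N) (h : r * (N + 1) ^ 2 < 2 ^ N) {k : ℕ}
    (hk : N ≤ k) : r * (k + 1) ^ 2 < 2 ^ k := by
  induction k, hk using Nat.le_induction with
  | base => exact h
  | succ k hk ih =>
    rw [pow_succ 2]
    -- This fails for k = 1, hence the requirement 2 ≤ N.
    have : (k + 1 + 1) ^ 2 ≤ 2 * (k + 1) ^ 2 := by nlinarith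
    nlinarith [Nat.mul_le_mul_left r this]

theorem lt_scaling {N r : ℕ} (hN : 2 ≤ N) (h : r * (N + 1) ^ 2 < 2 ^ N) (k : ℕ) (hk : N ≤ k) :
    2 * (r : ℤ) < scaling k.succPNat := by
  have h1 := mul_succ_sq_lt_two_pow hN h hk
  have h2 : 2 * r < (scaling k.succPNat : ℕ) := by
    change _ < ⌈(2 : ℝ) ^ (k.succPNat : ℕ) / (k.succPNat : ℝ) ^ 2⌉₊
    rw [Nat.lt_ceil, lt_div_iff₀ (by positivity)]
    have h3 : 2 * r * (k + 1) ^ 2 < 2 ^ (k + 1) := by rw [pow_succ 2]; linarith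
    have h4 : ((2 * r * (k + 1) ^ 2 : ℕ) : ℝ) < ((2 ^ (k + 1) : ℕ) : ℝ) := by exact_mod_cast h3
    push_cast at h4
    simpa using h4
  exact_mod_cast h2

/-- From cos θ ≥ 1 - θ²/2 and log x ≥ 1 - 1/x. The range covers every θ ≤ π/2, since π²/4 < 3. -/
theorem exp_neg_le_one_add_cos_div_two {θ : ℝ} (h : θ ^ 2 ≤ 3) :
    Real.exp (-(3 / 2 * θ ^ 2)) ≤ (1 + Real.cos θ) / 2 := by
  have hc := Real.one_sub_sq_div_two_le_cos (x := θ)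
  have hpos : 0 < 1 - θ ^ 2 / 4 := by linarith
  have hlog := Real.one_sub_inv_le_log_of_pos hpos
  rw [← Real.le_log_iff_exp_le (by linarith)]
  refine le_trans ?_ (Real.log_le_log hpos (by linarith))
  refine le_trans ?_ hlog
  have : (1 - θ ^ 2 / 4)⁻¹ ≤ 1 + 3 / 2 * θ ^ 2 := by
    rw [inv_le_iff_one_le_mul₀ hpos]
    nlinarith [sq_nonneg θ]
  linarith

theorem exp_le_transProb {N : ℕ} (hN : 2 ≤ N) (n : ℕ) :
    Real.exp (-(12 * n * (N + 1) ^ 4 / 4 ^ N + 224 * (N + 1) * 4 ^ N)) ≤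
      transProb scaling (2 * n) 1 1 := by
  obtain ⟨r, hr, hr'⟩ : ∃ r : ℕ, r * (N + 1) ^ 2 < 2 ^ N ∧ 2 ^ N ≤ (r + 1) * (N + 1) ^ 2 := by
    -- The largest r allowed by `lt_scaling`; maximality bounds r + 1 below and hence θ above.
    refine ⟨(2 ^ N - 1) / (N + 1) ^ 2, ?_, ?_⟩
    · have := Nat.div_mul_le_self (2 ^ N - 1) ((N + 1) ^ 2)
      have := Nat.one_le_two_pow (n := N)
      omega
    · have := Nat.lt_div_mul_add (a := 2 ^ N - 1) (b := (N + 1) ^ 2) (by positivity)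
      rw [add_mul, one_mul]
      omega
  set θ : ℝ := Real.pi / 2 / (r + 1) with hθ
  have hr0 : (0 : ℝ) < r + 1 := by positivity
  have hθ0 : 0 < θ := by positivity
  have hθ2 : θ ≤ Real.pi / 2 := div_le_self (by positivity) (by simp)
  have hπ := Real.pi_lt_d2
  have hπ0 := Real.pi_pos
  have hA := finite_confined (α := scaling) N r
  have hcard := ncard_confined_le (α := scaling) scaling_le (N := N) (r := r)
    (lt_of_le_of_lt (Nat.le_mul_of_pos_right r (by positivity)) hr)
  have hwalk := le_toOuterMeasure_walk (α := scaling) (by omega) (lt_scaling hN hr)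
    (div_mul_cancel₀ (Real.pi / 2) hr0.ne') n 0 1 (by simp) (one_mem_confinedSet N r)
  rw [← hθ, Int.cast_zero, mul_zero, Real.cos_zero, one_mul, ← hA.coe_toFinset,
    PMF.toOuterMeasure_apply_finset] at hwalk
  have hcs := sq_sum_transProb_le n hA.toFinset
  rw [← Set.ncard_eq_toFinset_card _ hA] at hcs
  have hsum : ((1 + Real.cos θ) / 2) ^ n ≤ ∑ x ∈ hA.toFinset, transProb scaling n 1 x := by
    rw [ENNReal.ofReal_le_iff_le_toReal, ENNReal.toReal_sum] at hwalk
    · exact hwalk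
    · exact fun x _ => PMF.apply_ne_top _ _
    · exact ENNReal.sum_ne_top.2 fun x _ => PMF.apply_ne_top _ _
  have hexp := exp_neg_le_one_add_cos_div_two (θ := θ) (by nlinarith)
  have hθsq : θ ^ 2 ≤ 4 * (N + 1) ^ 4 / 4 ^ N := by
    have h1 : (2 : ℝ) ^ N ≤ (r + 1) * (N + 1) ^ 2 := by exact_mod_cast hr'
    have h2 : (4 : ℝ) ^ N = 2 ^ N * 2 ^ N := by rw [← mul_pow]; norm_num
    have h3 : θ ≤ 2 * (N + 1) ^ 2 / 2 ^ N := by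
      rw [hθ, div_le_div_iff₀ hr0 (by positivity)]
      have : Real.pi / 2 ≤ 2 := by linarith
      calc _ ≤ 2 * ((r + 1) * ((N : ℝ) + 1) ^ 2) := by gcongr
        _ = _ := by ring
    calc θ ^ 2 ≤ (2 * (N + 1) ^ 2 / 2 ^ N) ^ 2 := by gcongr
      _ = _ := by rw [h2]; field_simp; ring
  have hp0 : 0 ≤ transProb scaling (2 * n) 1 1 := ENNReal.toReal_nonneg
  have hlow : Real.exp (-(12 * n * (N + 1) ^ 4 / 4 ^ N)) ≤
      (∑ x ∈ hA.toFinset, transProb scaling n 1 x) ^ 2 := by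
    calc Real.exp (-(12 * n * (N + 1) ^ 4 / 4 ^ N))
        ≤ Real.exp ((2 * n : ℕ) * (-(3 / 2 * θ ^ 2))) := by
          rw [Real.exp_le_exp]
          push_cast
          have h := mul_le_mul_of_nonneg_left hθsq (by positivity : (0 : ℝ) ≤ 3 * n)
          have h' : 3 * n * (4 * ((N : ℝ) + 1) ^ 4 / 4 ^ N) = 12 * n * (N + 1) ^ 4 / 4 ^ N := by
            ring
          linarith
      _ = (Real.exp (-(3 / 2 * θ ^ 2)) ^ n) ^ 2 := by rw [Real.exp_nat_mul, ← pow_mul, mul_comm n]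
      _ ≤ _ := by gcongr; exact (pow_le_pow_left₀ (Real.exp_pos _).le hexp n).trans hsum
  have hup : (Set.ncard {x : Wreath scaling |
      ∃ m : ℤ, |m| ≤ r ∧ x ∈ confinedSet scaling N r m} : ℝ) ≤
        Real.exp (224 * (N + 1) * 4 ^ N) := by
    have h2 : (2 : ℝ) ≤ Real.exp 1 := by linarith [Real.add_one_le_exp 1]
    calc _ ≤ (2 : ℝ) ^ (224 * (N + 1) * 4 ^ N) := by exact_mod_cast hcard
      _ ≤ Real.exp 1 ^ (224 * (N + 1) * 4 ^ N) := by gcongr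
      _ = _ := by rw [← Real.exp_nat_mul]; push_cast; rw [mul_one]
  rw [neg_add, Real.exp_add, Real.exp_neg (224 * (N + 1) * 4 ^ N), ← div_eq_mul_inv,
    div_le_iff₀ (Real.exp_pos _)]
  refine hlow.trans (hcs.trans ?_)
  rw [mul_comm]
  gcongr

theorem tendsto_log_one_add_log_div_log :
    Tendsto (fun n : ℕ => 4 * Real.log (1 + Real.log n) / Real.log n) atTop (𝓝 0) := by
  have h1 : Tendsto (fun x : ℝ => Real.log (1 + x) / x) atTop (𝓝 0) := by
    have h := Real.isLittleO_log_id_atTop.comp_tendsto (tendsto_atTop_add_const_left atTop (1 : ℝ)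
      tendsto_id)
    have h' : (fun x : ℝ => 1 + x) =O[atTop] fun x => x := by
      refine Asymptotics.IsBigO.of_bound 2 ?_
      filter_upwards [eventually_ge_atTop 1] with x hx
      rw [Real.norm_of_nonneg (by linarith), Real.norm_of_nonneg (by linarith)]
      linarith
    exact (h.trans_isBigO h').tendsto_div_nhds_zero
  have h2 := (h1.comp (Real.tendsto_log_atTop.comp tendsto_natCast_atTop_atTop)).const_mul 4
  simpa [Function.comp_def, mul_div_assoc] using h2

theorem rpow_half_add_eq {n : ℕ} (hn : 1 ≤ n) :
    (n : ℝ) ^ ((1 / 2 : ℝ) + 4 * Real.log (1 + Real.log n) / Real.log n) =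
      √n * (1 + Real.log n) ^ 4 := by
  have hn0 : (0 : ℝ) < n := by exact_mod_cast hn
  rw [Real.rpow_add hn0, ← Real.sqrt_eq_rpow]
  congr 1
  rcases hn.eq_or_lt with rfl | hn1
  -- At n = 1 the quotient is 0 / 0 = 0 and both sides equal 1.
  · simp
  · have hlog : 0 < Real.log n := Real.log_pos (by exact_mod_cast hn1)
    rw [Real.rpow_def_of_pos hn0, mul_div_cancel₀ _ hlog.ne', mul_comm, Real.exp_mul,
      Real.exp_log (by linarith)]
    norm_cast

/-- With l = ⌊log₁₆ n⌋ one has 4^l ≤ √n ≤ 4^(l+1), so N = l + 2 balances the two costs and satisfies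
2 ≤ N. The constant comes from (12 + 224 · 16) · 81 = 291276. -/
theorem exponent_le {n : ℕ} (hn : 1 ≤ n) :
    (12 * n * (((Nat.log 16 n + 2 : ℕ) : ℝ) + 1) ^ 4 / 4 ^ (Nat.log 16 n + 2) +
      224 * (((Nat.log 16 n + 2 : ℕ) : ℝ) + 1) * 4 ^ (Nat.log 16 n + 2)) ≤
        300000 * (√n * (1 + Real.log n) ^ 4) := by
  set l := Nat.log 16 n
  have hn0 : (0 : ℝ) < n := by exact_mod_cast hn
  have h1 : (16 : ℝ) ^ l ≤ n := by exact_mod_cast Nat.pow_log_le_self 16 (by omega)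
  have h2 : (n : ℝ) ≤ 16 ^ (l + 1) := by
    exact_mod_cast (Nat.lt_pow_succ_log_self (by norm_num) n).le
  have h16 : ∀ k : ℕ, (16 : ℝ) ^ k = (4 ^ k) ^ 2 := fun k => by
    rw [← pow_mul, mul_comm k, pow_mul]; norm_num
  have hs1 : (4 : ℝ) ^ l ≤ √n := Real.le_sqrt_of_sq_le (by rw [← h16]; exact h1)
  have hs2 : √n ≤ 4 ^ (l + 1) := Real.sqrt_le_left (by positivity) |>.2 (by rw [← h16]; exact h2)
  have hl : (l : ℝ) ≤ Real.log n := by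
    have h := Real.log_le_log (by positivity) h1
    rw [Real.log_pow] at h
    have : 1 ≤ Real.log 16 := by
      rw [Real.le_log_iff_exp_le (by norm_num)]
      linarith [Real.exp_one_lt_d9]
    nlinarith [Nat.cast_nonneg (α := ℝ) l]
  have hlog : 0 ≤ Real.log n := Real.log_natCast_nonneg n
  have hM : ((l + 2 : ℕ) : ℝ) + 1 ≤ 3 * (1 + Real.log n) := by push_cast; linarith
  have hM1 : (1 : ℝ) ≤ ((l + 2 : ℕ) : ℝ) + 1 := by simp; positivity
  generalize ((l + 2 : ℕ) : ℝ) + 1 = M at hM hM1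
  have hdiv : n / (4 : ℝ) ^ (l + 2) ≤ √n := by
    rw [div_le_iff₀ (by positivity)]
    calc (n : ℝ) = √n * √n := (Real.mul_self_sqrt hn0.le).symm
      _ ≤ √n * 4 ^ (l + 2) := by
        gcongr
        exact hs2.trans (pow_le_pow_right₀ (by norm_num) (by omega))
  have hM4 : M ^ 4 ≤ 81 * (1 + Real.log n) ^ 4 := by
    calc M ^ 4 ≤ (3 * (1 + Real.log n)) ^ 4 := by gcongr
      _ = _ := by ring
  calc 12 * n * M ^ 4 / 4 ^ (l + 2) + 224 * M * 4 ^ (l + 2)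
      = 12 * M ^ 4 * (n / 4 ^ (l + 2)) + 3584 * M * 4 ^ l := by rw [pow_add]; ring
    _ ≤ 12 * M ^ 4 * √n + 3584 * M ^ 4 * √n := by
        gcongr
        exact le_self_pow₀ hM1 (by norm_num)
    _ = 3596 * √n * M ^ 4 := by ring
    _ ≤ 3596 * √n * (81 * (1 + Real.log n) ^ 4) := by gcongr
    _ ≤ _ := by
        have : 0 ≤ √n * (1 + Real.log n) ^ 4 := by positivity
        linarith

end BubbleGroup

end

theorem mainTheorem7 :
    ∃ f : ℕ → ℝ, Tendsto f atTop (𝓝 0) ∧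
      ∃ c : ℝ, 0 < c ∧ ∃ K : ℝ, 0 < K ∧ ∀ n : ℕ, 1 ≤ n →
        K * Real.exp (-c * (n : ℝ) ^ ((1 / 2 : ℝ) + f n)) ≤
          BubbleGroup.transProb BubbleGroup.scaling (2 * n) 1 1 := by
  refine ⟨_, BubbleGroup.tendsto_log_one_add_log_div_log, 300000, by norm_num, 1, one_pos,
    fun n hn => ?_⟩
  rw [BubbleGroup.rpow_half_add_eq hn, one_mul]
  refine le_trans ?_ (BubbleGroup.exp_le_transProb (N := Nat.log 16 n + 2) (by omega) n)
  rw [Real.exp_le_exp, neg_mul]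
  exact neg_le_neg (BubbleGroup.exponent_le hn)
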